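/- Let $k\ge 1$, let $\Sigma$ be a fixed positive definite real $k\times k$ matrix, and let $(q_n)_{n\ge1}$ be a sequence of nonnegative integers with $q_n=o(n)$ as $n\to\infty$. For each $n$ let $$L_0[q_n]=\Bigl\{(\theta_1,\dots,\theta_n)\in(\mathbb{R}^k)^n:\ \#\{i:\theta_i\neq 0\}\le q_n\Bigr\},$$ and, for $\theta\in(\mathbb{R}^k)^n$, let $E_\theta$ denote expectation when $X_1,\dots,X_n$ are independent with $X_i\sim N_k(\theta_i,\Sigma)$. Write $\lVert x\rVert_\Sigma^2=x^{\top}\Sigma^{-1}x$. Then, as $n\to\infty$, $$\inf_{(\widehat\theta_1,\dots,\widehat\theta_n)}\ \sup_{\theta\in L_0[q_n]}\ \sum_{i=1}^n E_\theta\lVert\widehat\theta_i-\theta_i\rVert_\Sigma^2 \;=\; 2\,q_n\log\!\left(\frac{n}{q_n}\right)(1+o(1)),$$ where the infimum is over all estimators, i.e. all measurable functions $(\widehat\theta_1,\dots,\widehat\theta_n)$ of $(X_1,\dots,X_n)$ with values in $(\mathbb{R}^k)^n$, and the right-hand side is read as $0$ when $q_n=0$. -/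

import Mathlib

open MeasureTheory ProbabilityTheory Filter Topology Asymptotics
open scoped Matrix ENNReal

noncomputable section

namespace NearlyBlack

/-- The squared Mahalanobis norm `‖x‖_S² = xᵀ S⁻¹ x`. -/
def mahalanobisSq {k : ℕ} (S : Matrix (Fin k) (Fin k) ℝ) (x : EuclideanSpace ℝ (Fin k)) : ℝ :=
  x.ofLp ⬝ᵥ (S⁻¹ *ᵥ x.ofLp)

/-- The families of `n` vectors of `ℝᵏ` at most `q` of which are nonzero. -/
def nearlyBlack (k n q : ℕ) : Set (Fin n → EuclideanSpace ℝ (Fin k)) :=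
  {θ | {i | θ i ≠ 0}.ncard ≤ q}

/-- The joint law of independent `X_i ~ N_k(θ_i, S)`, `i = 1, …, n`. -/
def dataLaw {k n : ℕ} (S : Matrix (Fin k) (Fin k) ℝ)
    (θ : Fin n → EuclideanSpace ℝ (Fin k)) : Measure (Fin n → EuclideanSpace ℝ (Fin k)) :=
  Measure.pi fun i => multivariateGaussian (θ i) S

/-- The risk `∑ i, E_θ ‖δ_i(X) - θ_i‖_S²` of the estimator `δ`, with values in `[0, ∞]`. -/
def risk {k n : ℕ} (S : Matrix (Fin k) (Fin k) ℝ)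
    (δ : (Fin n → EuclideanSpace ℝ (Fin k)) → Fin n → EuclideanSpace ℝ (Fin k))
    (θ : Fin n → EuclideanSpace ℝ (Fin k)) : ℝ≥0∞ :=
  ∑ i, ∫⁻ x, ENNReal.ofReal (mahalanobisSq S (δ x i - θ i)) ∂(dataLaw S θ)

/-- The minimax risk over all (measurable) estimators, each `δ_i` being allowed to depend on the
whole sample, for mean families with at most `q` nonzero members. -/
def minimaxRisk {k : ℕ} (S : Matrix (Fin k) (Fin k) ℝ) (n q : ℕ) : ℝ≥0∞ :=
  ⨅ (δ : (Fin n → EuclideanSpace ℝ (Fin k)) → Fin n → EuclideanSpace ℝ (Fin k))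
    (_ : Measurable δ), ⨆ θ ∈ nearlyBlack k n q, risk S δ θ

end NearlyBlack

end

noncomputable section

namespace NearlyBlack

open scoped MatrixOrder

/-! Write `L = log (n / q)`. Since `q = o(n)`, `n / q` eventually exceeds any constant, so it
suffices to bound the risk by `2 q L (1 ± ε)` once `n ≥ T q`, with `T` depending on `ε` (and `S`).

Upper bound: whiten by `S^{-1/2}` and hard-threshold at `t² = 2 (1 + η) L`. A zero mean costs `O(exp
(-t² / (2 (1 + η)))) = O(q / n)`, hence `O(q)` over all coordinates. Any mean costs at most `(1 + η)
t² + O(1)`, and this is paid at most `q` times.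

Lower bound: the supremum dominates an average over `q` disjoint blocks of `m = n / q` coordinates,
each with one spike of whitened length `τ`, `τ² = 2 (1 - η) log m`, at a uniform position. Below the
detection level `2 log m` the position cannot be found, and almost all of `τ²` is lost in every
block. The posterior weights are handled by `sum_exp_le_sum_mul_loss`, an inequality between finite
sums; integrating it against the law with the spike removed needs only that likelihood ratios have
mean one. -/

/-- A product of measures with densities has the product density. -/
lemma pi_withDensity {ι : Type*} [Fintype ι] {X : ι → Type*} {mX : ∀ i, MeasurableSpace (X i)}
    (μ : ∀ i, Measure (X i)) [∀ i, IsProbabilityMeasure (μ i)] (f : ∀ i, X i → ℝ≥0∞)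
    (hf : ∀ i, Measurable (f i)) [∀ i, SigmaFinite ((μ i).withDensity (f i))] :
    Measure.pi (fun i => (μ i).withDensity (f i)) =
      (Measure.pi μ).withDensity fun x => ∏ i, f i (x i) := by
  refine Measure.pi_eq fun s hs => ?_
  rw [withDensity_apply _ (MeasurableSet.univ_pi hs), ← lintegral_indicator (MeasurableSet.univ_pi hs)]
  have hm : ∀ i, Measurable ((s i).indicator (f i)) := fun i => (hf i).indicator (hs i)
  have h : ∀ x : ∀ i, X i, (Set.univ.pi s).indicator (fun x => ∏ i, f i (x i)) x =
      ∏ i, (s i).indicator (f i) (x i) := by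
    intro x
    by_cases hx : x ∈ Set.univ.pi s
    · rw [Set.indicator_of_mem hx]
      exact Finset.prod_congr rfl fun i _ => (Set.indicator_of_mem (hx i trivial) _).symm
    · rw [Set.indicator_of_notMem hx]
      obtain ⟨i, hi⟩ : ∃ i, x i ∉ s i := by simpa [Set.mem_pi] using hx
      exact (Finset.prod_eq_zero (Finset.mem_univ i) (Set.indicator_of_notMem hi _)).symm
  simp_rw [h]
  have hind := iIndepFun_pi (μ := μ) (X := fun i => (s i).indicator (f i))
    fun i => (hm i).aemeasurable
  rw [lintegral_prod_eq_prod_lintegral_of_indepFun Finset.univ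
    (fun i (x : ∀ i, X i) => (s i).indicator (f i) (x i)) hind fun i => (hm i).comp (measurable_pi_apply i)]
  refine Finset.prod_congr rfl fun i _ => ?_
  rw [withDensity_apply _ (hs i), ← lintegral_indicator (hs i),
    (measurePreserving_eval μ i).lintegral_comp (hm i)]

lemma gaussianReal_eq_withDensity (v : ℝ) :
    gaussianReal v 1 =
      (gaussianReal 0 1).withDensity fun x => ENNReal.ofReal (Real.exp (v * x - v ^ 2 / 2)) := by
  rw [gaussianReal_of_var_ne_zero _ one_ne_zero, gaussianReal_of_var_ne_zero _ one_ne_zero,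
    ← withDensity_mul _ (measurable_gaussianPDF _ _) (by fun_prop)]
  congr 1
  ext x
  simp only [Pi.mul_apply, gaussianPDF, gaussianPDFReal]
  rw [← ENNReal.ofReal_mul (by positivity), mul_assoc _ (Real.exp _) (Real.exp _), ← Real.exp_add]
  congr 3
  simp
  ring

/-! ### Gaussian vectors and whitening -/

variable {k : ℕ}

/-- The density of a shifted standard Gaussian vector. -/
lemma lintegral_stdGaussian_add (v : EuclideanSpace ℝ (Fin k)) {g : EuclideanSpace ℝ (Fin k) → ℝ≥0∞}
    (hg : Measurable g) :
    ∫⁻ z, g (v + z) ∂stdGaussian (EuclideanSpace ℝ (Fin k)) =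
      ∫⁻ z, ENNReal.ofReal (Real.exp (inner ℝ v z - ‖v‖ ^ 2 / 2)) * g z
        ∂stdGaussian (EuclideanSpace ℝ (Fin k)) := by
  have hL : Measurable (WithLp.toLp 2 : (Fin k → ℝ) → EuclideanSpace ℝ (Fin k)) := by fun_prop
  have hshift : (Measure.pi fun _ : Fin k => gaussianReal 0 1).map (fun x i => v i + x i) =
      Measure.pi fun i => gaussianReal (v i) 1 := by
    have := Measure.pi_map_pi (μ := fun _ : Fin k => gaussianReal 0 1)
      (f := fun i x => v i + x) (fun i => by fun_prop)
    rw [this]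
    congr 1
    ext1 i
    rw [gaussianReal_map_const_add, zero_add]
  have hpi : (Measure.pi fun i => gaussianReal (v i) 1) =
      (Measure.pi fun _ : Fin k => gaussianReal 0 1).withDensity
        fun x => ∏ i, ENNReal.ofReal (Real.exp (v i * x i - v i ^ 2 / 2)) := by
    have : ∀ i, SigmaFinite ((gaussianReal 0 1).withDensity
        fun x => ENNReal.ofReal (Real.exp (v i * x - v i ^ 2 / 2))) := fun i => by
      rw [← gaussianReal_eq_withDensity]; infer_instance
    rw [← pi_withDensity (fun _ => gaussianReal 0 1)
      (fun i x => ENNReal.ofReal (Real.exp (v i * x - v i ^ 2 / 2))) (fun i => by fun_prop)]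
    congr 1
    ext1 i
    exact gaussianReal_eq_withDensity _
  rw [← map_pi_eq_stdGaussian, lintegral_map (by fun_prop) hL, lintegral_map (by fun_prop) hL]
  have h1 : ∀ x : Fin k → ℝ, g (v + WithLp.toLp 2 x) = g (WithLp.toLp 2 fun i => v i + x i) := by
    intro x
    congr 1
  simp_rw [h1]
  rw [← lintegral_map (f := fun y => g (WithLp.toLp 2 y)) (g := fun (x : Fin k → ℝ) i => v i + x i)
    (by fun_prop) (by fun_prop), hshift, hpi,
    lintegral_withDensity_eq_lintegral_mul _ (by fun_prop) (by fun_prop)]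
  refine lintegral_congr fun x => ?_
  rw [Pi.mul_apply, ← ENNReal.ofReal_prod_of_nonneg (fun i _ => (Real.exp_pos _).le),
    ← Real.exp_sum, Finset.sum_sub_distrib, EuclideanSpace.real_norm_sq_eq, Finset.sum_div]
  simp [PiLp.inner_apply, mul_comm]

/-- Exponential moments of the squared norm of a standard Gaussian vector. -/
lemma lintegral_exp_sq_stdGaussian_ne_top {a : ℝ} (ha : a < 1 / 2) :
    ∫⁻ z, ENNReal.ofReal (Real.exp (a * ‖z‖ ^ 2)) ∂stdGaussian (EuclideanSpace ℝ (Fin k)) ≠ ∞ := by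
  have h1 : Integrable (fun x : ℝ => Real.exp (a * x ^ 2)) (gaussianReal 0 1) := by
    rw [gaussianReal_of_var_ne_zero _ one_ne_zero,
      integrable_withDensity_iff (measurable_gaussianPDF _ _) (by simp [gaussianPDF_lt_top])]
    have := (integrable_exp_neg_mul_sq (b := 1 / 2 - a) (by linarith)).mul_const
      (Real.sqrt (2 * Real.pi))⁻¹
    refine this.congr (Eventually.of_forall fun x => ?_)
    simp only [toReal_gaussianPDF, gaussianPDFReal, NNReal.coe_one, mul_one, sub_zero]
    rw [mul_comm (Real.exp (a * x ^ 2)), mul_assoc, ← Real.exp_add, mul_comm]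
    congr 2
    ring
  have h2 := Integrable.fintype_prod (μ := fun _ : Fin k => gaussianReal 0 1) (fun _ : Fin k => h1)
  rw [← map_pi_eq_stdGaussian, lintegral_map (by fun_prop) (by fun_prop)]
  have h3 := h2.lintegral_lt_top.ne
  convert h3 using 5 with x
  rw [← Real.exp_sum, EuclideanSpace.real_norm_sq_eq, Finset.mul_sum]

/-- The inverse of the square root of a positive definite matrix whitens the Mahalanobis norm. -/
lemma exists_whitening {S : Matrix (Fin k) (Fin k) ℝ} (hS : S.PosDef) :
    ∃ W : EuclideanSpace ℝ (Fin k) →L[ℝ] EuclideanSpace ℝ (Fin k),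
      (∀ x, mahalanobisSq S x = ‖W x‖ ^ 2) ∧
      ∀ z, W (Matrix.toEuclideanCLM (𝕜 := ℝ) (CFC.sqrt S) z) = z := by
  have h0 : (0 : Matrix (Fin k) (Fin k) ℝ) ≤ S := hS.posSemidef.nonneg
  have hsq : CFC.sqrt S * CFC.sqrt S = S := CFC.sqrt_mul_sqrt_self S h0
  have hdet : IsUnit (CFC.sqrt S).det := by
    have : IsUnit S.det := hS.det_pos.ne'.isUnit
    rw [← hsq, Matrix.det_mul] at this
    exact isUnit_of_mul_isUnit_left this
  have hsym : ((CFC.sqrt S)⁻¹)ᵀ = (CFC.sqrt S)⁻¹ := by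
    have : ((CFC.sqrt S)⁻¹).IsHermitian :=
      ((Matrix.nonneg_iff_posSemidef.1 (CFC.sqrt_nonneg S)).isHermitian).inv
    simpa [Matrix.IsHermitian, Matrix.conjTranspose_eq_transpose_of_trivial] using this
  refine ⟨Matrix.toEuclideanCLM (𝕜 := ℝ) (CFC.sqrt S)⁻¹, fun x => ?_, fun z => ?_⟩
  · rw [EuclideanSpace.real_norm_sq_eq, mahalanobisSq]
    conv_lhs => rw [← hsq, Matrix.mul_inv_rev, ← Matrix.mulVec_mulVec, Matrix.dotProduct_mulVec,
      ← Matrix.mulVec_transpose, hsym]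
    simp [dotProduct, sq]
  · rw [← ContinuousLinearMap.comp_apply, ← ContinuousLinearMap.mul_def, ← map_mul,
      Matrix.nonsing_inv_mul _ hdet, map_one]
    rfl

lemma lintegral_multivariateGaussian (S : Matrix (Fin k) (Fin k) ℝ) (μ : EuclideanSpace ℝ (Fin k))
    {g : EuclideanSpace ℝ (Fin k) → ℝ≥0∞} (hg : Measurable g) :
    ∫⁻ x, g x ∂multivariateGaussian μ S =
      ∫⁻ z, g (μ + Matrix.toEuclideanCLM (𝕜 := ℝ) (CFC.sqrt S) z)
        ∂stdGaussian (EuclideanSpace ℝ (Fin k)) := by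
  rw [multivariateGaussian, lintegral_map hg (by fun_prop)]

lemma lintegral_dataLaw_eval {n : ℕ} (S : Matrix (Fin k) (Fin k) ℝ)
    (θ : Fin n → EuclideanSpace ℝ (Fin k)) (i : Fin n)
    {g : EuclideanSpace ℝ (Fin k) → ℝ≥0∞} (hg : Measurable g) :
    ∫⁻ x, g (x i) ∂dataLaw S θ = ∫⁻ x, g x ∂multivariateGaussian (θ i) S :=
  (measurePreserving_eval (fun i => multivariateGaussian (θ i) S) i).lintegral_comp hg

/-! ### Upper bound: hard thresholding -/

/-- Hard thresholding at level `t` of the whitened norm. -/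
def hardThreshold (W : EuclideanSpace ℝ (Fin k) →L[ℝ] EuclideanSpace ℝ (Fin k)) (t : ℝ)
    (x : EuclideanSpace ℝ (Fin k)) : EuclideanSpace ℝ (Fin k) :=
  if t < ‖W x‖ then x else 0

lemma measurable_hardThreshold (W : EuclideanSpace ℝ (Fin k) →L[ℝ] EuclideanSpace ℝ (Fin k))
    (t : ℝ) : Measurable (hardThreshold W t) :=
  Measurable.ite (measurableSet_lt measurable_const (by fun_prop)) measurable_id measurable_const

/-- The risk of hard thresholding at the mean zero. -/
lemma exists_hardThreshold_risk_zero_le {S : Matrix (Fin k) (Fin k) ℝ}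
    {W : EuclideanSpace ℝ (Fin k) →L[ℝ] EuclideanSpace ℝ (Fin k)}
    (hW : ∀ z, W (Matrix.toEuclideanCLM (𝕜 := ℝ) (CFC.sqrt S) z) = z)
    {a : ℝ} (ha0 : 0 ≤ a) (ha : a < 1 / 2) :
    ∃ C : ℝ, 0 ≤ C ∧ ∀ t, 0 ≤ t →
      ∫⁻ x, ENNReal.ofReal (‖W (hardThreshold W t x)‖ ^ 2) ∂multivariateGaussian 0 S ≤
        ENNReal.ofReal (C * Real.exp (-(a * t ^ 2))) := by
  -- The spare exponent `b` absorbs the factor `‖z‖²`: where `‖z‖ > t`, `b ‖z‖² ≤ exp (b ‖z‖² + a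
  -- (‖z‖² - t²))`.
  obtain ⟨b, hb, hab⟩ : ∃ b : ℝ, 0 < b ∧ a + b < 1 / 2 := ⟨(1 / 2 - a) / 2, by linarith, by linarith⟩
  have hfin := lintegral_exp_sq_stdGaussian_ne_top (k := k) hab
  set M := ∫⁻ z, ENNReal.ofReal (Real.exp ((a + b) * ‖z‖ ^ 2))
    ∂stdGaussian (EuclideanSpace ℝ (Fin k)) with hM
  refine ⟨b⁻¹ * M.toReal, by positivity, fun t ht => ?_⟩
  rw [lintegral_multivariateGaussian _ _ (by
    have := measurable_hardThreshold W t
    fun_prop)]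
  have hpt : ∀ z : EuclideanSpace ℝ (Fin k),
      ENNReal.ofReal (‖W (hardThreshold W t
        (0 + Matrix.toEuclideanCLM (𝕜 := ℝ) (CFC.sqrt S) z))‖ ^ 2) ≤
      ENNReal.ofReal (b⁻¹ * Real.exp (-(a * t ^ 2))) *
        ENNReal.ofReal (Real.exp ((a + b) * ‖z‖ ^ 2)) := by
    intro z
    rw [← ENNReal.ofReal_mul (by positivity), mul_assoc, ← Real.exp_add]
    apply ENNReal.ofReal_le_ofReal
    rw [zero_add, hardThreshold, hW]
    split_ifs with h
    · rw [hW]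
      have h1 : t ^ 2 ≤ ‖z‖ ^ 2 := by gcongr
      have h2 : b * ‖z‖ ^ 2 ≤ Real.exp (-(a * t ^ 2) + (a + b) * ‖z‖ ^ 2) := by
        refine le_trans ?_ (Real.add_one_le_exp _)
        nlinarith [mul_le_mul_of_nonneg_left h1 ha0]
      rwa [inv_mul_eq_div, le_div_iff₀ hb, mul_comm]
    · rw [map_zero, norm_zero, zero_pow two_ne_zero]
      positivity
  refine (lintegral_mono hpt).trans (le_of_eq ?_)
  rw [lintegral_const_mul' _ _ ENNReal.ofReal_ne_top, ← hM, ← ENNReal.ofReal_toReal hfin,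
    ← ENNReal.ofReal_mul (by positivity), ENNReal.toReal_ofReal (by positivity)]
  congr 1
  ring

/-- The risk of hard thresholding at an arbitrary mean. -/
lemma exists_hardThreshold_risk_le {S : Matrix (Fin k) (Fin k) ℝ}
    {W : EuclideanSpace ℝ (Fin k) →L[ℝ] EuclideanSpace ℝ (Fin k)}
    (hW : ∀ z, W (Matrix.toEuclideanCLM (𝕜 := ℝ) (CFC.sqrt S) z) = z)
    {η : ℝ} (hη : 0 < η) :
    ∃ C : ℝ, 0 ≤ C ∧ ∀ t, 0 ≤ t → ∀ μ,
      ∫⁻ x, ENNReal.ofReal (‖W (hardThreshold W t x - μ)‖ ^ 2) ∂multivariateGaussian μ S ≤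
        ENNReal.ofReal ((1 + η) * t ^ 2 + C) := by
  have hfin := lintegral_exp_sq_stdGaussian_ne_top (k := k) (a := 1 / 4) (by norm_num)
  set M := ∫⁻ z, ENNReal.ofReal (Real.exp (1 / 4 * ‖z‖ ^ 2))
    ∂stdGaussian (EuclideanSpace ℝ (Fin k)) with hM
  refine ⟨(1 + η⁻¹) * 4 * M.toReal, by positivity, fun t ht μ => ?_⟩
  rw [lintegral_multivariateGaussian _ _ (by
    have := measurable_hardThreshold W t
    fun_prop)]
  have hpt : ∀ z : EuclideanSpace ℝ (Fin k),
      ENNReal.ofReal (‖W (hardThreshold W t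
        (μ + Matrix.toEuclideanCLM (𝕜 := ℝ) (CFC.sqrt S) z) - μ)‖ ^ 2) ≤
      ENNReal.ofReal ((1 + η) * t ^ 2) + ENNReal.ofReal ((1 + η⁻¹) * 4) *
        ENNReal.ofReal (Real.exp (1 / 4 * ‖z‖ ^ 2)) := by
    intro z
    rw [← ENNReal.ofReal_mul (by positivity), ← ENNReal.ofReal_add (by positivity) (by positivity)]
    apply ENNReal.ofReal_le_ofReal
    have h1 : ‖z‖ ^ 2 ≤ 4 * Real.exp (1 / 4 * ‖z‖ ^ 2) := by
      linarith [Real.add_one_le_exp (1 / 4 * ‖z‖ ^ 2)]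
    have h2 : (‖z‖ + t) ^ 2 ≤ (1 + η) * t ^ 2 + (1 + η⁻¹) * ‖z‖ ^ 2 := by
      have : 0 ≤ η⁻¹ * (‖z‖ - η * t) ^ 2 := by positivity
      have e : η⁻¹ * (‖z‖ - η * t) ^ 2 = η⁻¹ * ‖z‖ ^ 2 - 2 * ‖z‖ * t + η * t ^ 2 := by
        field_simp
        ring
      nlinarith
    -- If the observation is kept, the error is the noise `z`; if it is killed, `‖W μ + z‖ ≤ t`, so
    -- `‖W μ‖ ≤ ‖z‖ + t`.
    have h3 : ‖W (hardThreshold W t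
        (μ + Matrix.toEuclideanCLM (𝕜 := ℝ) (CFC.sqrt S) z) - μ)‖ ≤ ‖z‖ + t := by
      rw [hardThreshold]
      split_ifs with h
      · rw [add_sub_cancel_left, hW]
        linarith
      · rw [map_add, hW] at h
        have e : W (0 - μ) = z - (W μ + z) := by simp
        rw [e]
        exact (norm_sub_le _ _).trans (by gcongr; exact not_lt.1 h)
    calc _ ≤ (‖z‖ + t) ^ 2 := by gcongr
      _ ≤ _ := h2
      _ ≤ _ := by
        rw [mul_assoc]
        gcongr
  refine (lintegral_mono hpt).trans (le_of_eq ?_)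
  rw [lintegral_add_left measurable_const, lintegral_const, measure_univ, mul_one,
    lintegral_const_mul' _ _ ENNReal.ofReal_ne_top, ← hM, ← ENNReal.ofReal_toReal hfin,
    ← ENNReal.ofReal_mul (by positivity), ENNReal.toReal_ofReal (by positivity),
    ← ENNReal.ofReal_add (by positivity) (by positivity)]

lemma minimaxRisk_le {S : Matrix (Fin k) (Fin k) ℝ} {n q : ℕ}
    {δ : (Fin n → EuclideanSpace ℝ (Fin k)) → Fin n → EuclideanSpace ℝ (Fin k)}
    (hδ : Measurable δ) {R : ℝ≥0∞} (h : ∀ θ ∈ nearlyBlack k n q, risk S δ θ ≤ R) :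
    minimaxRisk S n q ≤ R :=
  (iInf₂_le δ hδ).trans (iSup₂_le h)

lemma minimaxRisk_zero (S : Matrix (Fin k) (Fin k) ℝ) (n : ℕ) : minimaxRisk S n 0 = 0 := by
  refine le_antisymm (minimaxRisk_le (δ := fun _ _ => 0) measurable_const fun θ hθ => ?_) bot_le
  have h0 : ∀ i, θ i = 0 := by
    have h : {i | θ i ≠ 0}.ncard = 0 := Nat.le_zero.1 hθ
    rw [Set.ncard_eq_zero] at h
    intro i
    by_contra hi
    exact (Set.eq_empty_iff_forall_notMem.1 h) i hi
  simp [risk, h0, mahalanobisSq]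

/-- Charging `A` to every coordinate and an extra `B` to the nonzero ones avoids counting the zeros.
-/
lemma sum_le_of_mem_nearlyBlack {n q : ℕ} {θ : Fin n → EuclideanSpace ℝ (Fin k)}
    (hθ : θ ∈ nearlyBlack k n q) {r : Fin n → ℝ≥0∞} {A B : ℝ≥0∞}
    (hA : ∀ i, θ i = 0 → r i ≤ A) (hB : ∀ i, r i ≤ B) : ∑ i, r i ≤ n * A + q * B := by
  classical
  have h : ∀ i, r i ≤ A + if θ i ≠ 0 then B else 0 := by
    intro i
    split_ifs with hi
    · exact (hB i).trans le_add_self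
    · simpa using hA i (not_not.1 hi)
  refine (Finset.sum_le_sum fun i _ => h i).trans ?_
  rw [Finset.sum_add_distrib, ← Finset.sum_filter, Finset.sum_const, Finset.sum_const,
    Finset.card_univ, Fintype.card_fin, nsmul_eq_mul, nsmul_eq_mul]
  gcongr
  have : {i | θ i ≠ 0}.ncard ≤ q := hθ
  rw [Set.ncard_eq_toFinset_card'] at this
  refine le_trans (le_of_eq (congrArg Finset.card ?_)) this
  ext i
  simp

/-- Hard thresholding attains the asymptotic minimax risk. -/
lemma exists_forall_minimaxRisk_le {S : Matrix (Fin k) (Fin k) ℝ} (hS : S.PosDef) {ε : ℝ}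
    (hε : 0 < ε) :
    ∃ T : ℝ, ∀ n q : ℕ, 0 < q → T * q ≤ n → minimaxRisk S n q ≤
      ENNReal.ofReal (2 * (q : ℝ) * Real.log ((n : ℝ) / (q : ℝ)) * (1 + ε)) := by
  obtain ⟨W, hmW, hW⟩ := exists_whitening hS
  obtain ⟨η, hη, hη1, hηε⟩ : ∃ η : ℝ, 0 < η ∧ η ≤ 1 ∧ 6 * η ≤ ε :=
    ⟨min (ε / 6) 1, by positivity, min_le_right _ _, by linarith [min_le_left (ε / 6) 1]⟩
  have ha : 1 / (2 * (1 + η)) < 1 / 2 := by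
    apply one_div_lt_one_div_of_lt <;> linarith
  obtain ⟨C₁, hC₁, hzero⟩ := exists_hardThreshold_risk_zero_le hW (by positivity) ha
  obtain ⟨C₂, hC₂, hgen⟩ := exists_hardThreshold_risk_le hW hη
  refine ⟨Real.exp ((C₁ + C₂) / ε), fun n q hq hn => ?_⟩
  have hq' : (0 : ℝ) < q := by exact_mod_cast hq
  have hn' : (0 : ℝ) < n := lt_of_lt_of_le (by positivity) hn
  set L := Real.log ((n : ℝ) / q) with hL
  have hL1 : (C₁ + C₂) / ε ≤ L := by
    rw [hL, Real.le_log_iff_exp_le (by positivity), le_div_iff₀ hq']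
    exact hn
  have hL0 : 0 ≤ L := le_trans (by positivity) hL1
  have hLC : C₁ + C₂ ≤ L * ε := (div_le_iff₀ hε).1 hL1
  set t := Real.sqrt (2 * (1 + η) * L) with ht
  have ht2 : t ^ 2 = 2 * (1 + η) * L := Real.sq_sqrt (by positivity)
  -- The exponent `1 / (2 (1 + η))` is matched to `t`, so that the `n` zero coordinates cost `C₁ q`
  -- in total.
  have hexp : Real.exp (-(1 / (2 * (1 + η)) * t ^ 2)) = q / n := by
    rw [ht2, ← mul_assoc, one_div_mul_cancel (by positivity), one_mul, hL, ← Real.log_inv,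
      Real.exp_log (by positivity), inv_div]
  refine minimaxRisk_le (δ := fun x i => hardThreshold W t (x i)) ?_ fun θ hθ => ?_
  · exact measurable_pi_lambda _ fun i =>
      (measurable_hardThreshold W t).comp (measurable_pi_apply i)
  have hm : ∀ μ, Measurable fun x => ENNReal.ofReal (‖W (hardThreshold W t x - μ)‖ ^ 2) := by
    have := measurable_hardThreshold W t
    fun_prop
  have hB : ∀ i, ∫⁻ x, ENNReal.ofReal (mahalanobisSq S (hardThreshold W t (x i) - θ i))
      ∂dataLaw S θ ≤ ENNReal.ofReal ((1 + η) * t ^ 2 + C₂) := fun i => by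
    simp_rw [hmW]
    rw [lintegral_dataLaw_eval S θ i (hm (θ i))]
    exact hgen t (Real.sqrt_nonneg _) _
  have hA : ∀ i, θ i = 0 →
      ∫⁻ x, ENNReal.ofReal (mahalanobisSq S (hardThreshold W t (x i) - θ i))
      ∂dataLaw S θ ≤ ENNReal.ofReal (C₁ * (q / n)) := fun i hi => by
    simp_rw [hmW]
    rw [lintegral_dataLaw_eval S θ i (hm (θ i)), hi, ← hexp]
    simpa using hzero t (Real.sqrt_nonneg _)
  refine (sum_le_of_mem_nearlyBlack hθ hA hB).trans ?_
  rw [← ENNReal.ofReal_natCast, ← ENNReal.ofReal_natCast, ← ENNReal.ofReal_mul (by positivity),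
    ← ENNReal.ofReal_mul (by positivity), ← ENNReal.ofReal_add (by positivity) (by positivity)]
  apply ENNReal.ofReal_le_ofReal
  have e : (n : ℝ) * (C₁ * (q / n)) = q * C₁ := by field_simp
  rw [e, ht2]
  have h1 : (1 + η) * (1 + η) ≤ 1 + ε / 2 := by nlinarith
  have h2 : (1 + η) * (1 + η) * L ≤ (1 + ε / 2) * L := by gcongr
  have h3 : C₁ + ((1 + η) * (2 * (1 + η) * L) + C₂) ≤ 2 * L * (1 + ε) := by linarith
  calc (q : ℝ) * C₁ + q * ((1 + η) * (2 * (1 + η) * L) + C₂)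
      = q * (C₁ + ((1 + η) * (2 * (1 + η) * L) + C₂)) := by ring
    _ ≤ q * (2 * L * (1 + ε)) := by gcongr
    _ = _ := by ring

/-! ### Likelihood ratios for one spike -/

/-- The logarithm of the likelihood ratio of the mean `s • S^{1/2} e` against the mean `0`, where
`W = S^{-1/2}`. -/
def logLik (W : EuclideanSpace ℝ (Fin k) →L[ℝ] EuclideanSpace ℝ (Fin k))
    (e : EuclideanSpace ℝ (Fin k)) (s : ℝ) (x : EuclideanSpace ℝ (Fin k)) : ℝ :=
  s * inner ℝ e (W x) - s ^ 2 / 2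

@[fun_prop]
lemma measurable_logLik (W : EuclideanSpace ℝ (Fin k) →L[ℝ] EuclideanSpace ℝ (Fin k))
    (e : EuclideanSpace ℝ (Fin k)) (s : ℝ) : Measurable (logLik W e s) := by
  unfold logLik
  fun_prop

lemma multivariateGaussian_eq_withDensity {S : Matrix (Fin k) (Fin k) ℝ}
    {W : EuclideanSpace ℝ (Fin k) →L[ℝ] EuclideanSpace ℝ (Fin k)}
    (hW : ∀ z, W (Matrix.toEuclideanCLM (𝕜 := ℝ) (CFC.sqrt S) z) = z)
    {e : EuclideanSpace ℝ (Fin k)} (he : ‖e‖ = 1) (s : ℝ) :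
    multivariateGaussian (s • Matrix.toEuclideanCLM (𝕜 := ℝ) (CFC.sqrt S) e) S =
      (multivariateGaussian 0 S).withDensity
        fun x => ENNReal.ofReal (Real.exp (logLik W e s x)) := by
  refine Measure.ext_of_lintegral _ fun g hg => ?_
  rw [lintegral_withDensity_eq_lintegral_mul _ (by fun_prop) hg,
    lintegral_multivariateGaussian _ _ hg, lintegral_multivariateGaussian _ _ (by fun_prop)]
  have h := lintegral_stdGaussian_add (s • e)
    (g := fun z => g (Matrix.toEuclideanCLM (𝕜 := ℝ) (CFC.sqrt S) z)) (by fun_prop)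
  simp only [map_add, map_smul] at h
  rw [h]
  refine lintegral_congr fun z => ?_
  rw [Pi.mul_apply, zero_add, logLik, hW, inner_smul_left, norm_smul, he]
  simp

lemma lintegral_exp_logLik {S : Matrix (Fin k) (Fin k) ℝ}
    {W : EuclideanSpace ℝ (Fin k) →L[ℝ] EuclideanSpace ℝ (Fin k)}
    (hW : ∀ z, W (Matrix.toEuclideanCLM (𝕜 := ℝ) (CFC.sqrt S) z) = z)
    {e : EuclideanSpace ℝ (Fin k)} (he : ‖e‖ = 1) (s : ℝ) :
    ∫⁻ x, ENNReal.ofReal (Real.exp (logLik W e s x)) ∂multivariateGaussian 0 S = 1 := by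
  have h := congrArg (fun μ => μ Set.univ) (multivariateGaussian_eq_withDensity hW he s)
  simpa using h.symm

/-- Only one factor of the product changes, so all positions of a spike in a block are dominated by
the same law, that of the block without spike. -/
lemma dataLaw_update_eq_withDensity {n : ℕ} {S : Matrix (Fin k) (Fin k) ℝ}
    {W : EuclideanSpace ℝ (Fin k) →L[ℝ] EuclideanSpace ℝ (Fin k)}
    (hW : ∀ z, W (Matrix.toEuclideanCLM (𝕜 := ℝ) (CFC.sqrt S) z) = z)
    {e : EuclideanSpace ℝ (Fin k)} (he : ‖e‖ = 1) (s : ℝ)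
    {θ : Fin n → EuclideanSpace ℝ (Fin k)} {i : Fin n} (hi : θ i = 0) :
    dataLaw S (Function.update θ i (s • Matrix.toEuclideanCLM (𝕜 := ℝ) (CFC.sqrt S) e)) =
      (dataLaw S θ).withDensity fun x => ENNReal.ofReal (Real.exp (logLik W e s (x i))) := by
  have hμ : ∀ j, multivariateGaussian
      (Function.update θ i (s • Matrix.toEuclideanCLM (𝕜 := ℝ) (CFC.sqrt S) e) j) S =
      (multivariateGaussian (θ j) S).withDensity fun x =>
        if j = i then ENNReal.ofReal (Real.exp (logLik W e s x)) else 1 := by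
    intro j
    by_cases hj : j = i
    · subst hj
      simp only [Function.update_self, if_true, hi]
      exact multivariateGaussian_eq_withDensity hW he s
    · simp only [Function.update_of_ne hj, if_neg hj]
      exact withDensity_one.symm
  have : ∀ j, SigmaFinite ((multivariateGaussian (θ j) S).withDensity fun x =>
      if j = i then ENNReal.ofReal (Real.exp (logLik W e s x)) else 1) := fun j => by
    rw [← hμ]
    infer_instance
  unfold dataLaw
  simp_rw [hμ]
  rw [pi_withDensity (fun j => multivariateGaussian (θ j) S)
    (fun j x => if j = i then ENNReal.ofReal (Real.exp (logLik W e s x)) else 1)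
    (fun j => by split_ifs <;> fun_prop)]
  congr 1
  ext x
  simp

/-! ### Bayes risk of one block -/

/-- The pointwise inequality behind the Bayes risk bound for a single spike of unknown position:
`exp (l j)` is the likelihood of position `j`, and `a` is any guess of the indicator of it. -/
lemma sum_exp_le_sum_mul_loss {ι : Type*} [Fintype ι] [DecidableEq ι] (l a : ι → ℝ) (κ : ℝ)
    {r : ℝ} (hr : 0 ≤ r) :
    ∑ j, Real.exp (l j) ≤ ∑ j, ∑ i, Real.exp (l j) * (a i - if i = j then 1 else 0) ^ 2 +
      ∑ j, Real.exp (l j + r * (l j - κ)) + Real.exp κ := by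
  set s := ∑ j, Real.exp (l j) with hs
  have hle : ∀ i, Real.exp (l i) ≤ s := fun i =>
    Finset.single_le_sum (f := fun j => Real.exp (l j)) (fun j _ => (Real.exp_pos _).le)
      (Finset.mem_univ i)
  -- Completing the square around the posterior weight `w = exp (l i) / s` leaves a loss of at least
  -- `exp (l i) * (1 - w)`. The deficit `exp (l i) * w` is at most `exp κ * w` if `l i ≤ κ`, and
  -- otherwise is bounded by a Chernoff factor, using `w ≤ 1`.
  have key : ∀ i, Real.exp (l i) ≤ ∑ j, Real.exp (l j) * (a i - if i = j then 1 else 0) ^ 2 +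
      Real.exp (l i + r * (l i - κ)) + Real.exp κ * (Real.exp (l i) / s) := by
    intro i
    have hs0 : 0 < s := (Real.exp_pos _).trans_le (hle i)
    have h1 : ∑ j, Real.exp (l j) * (a i - if i = j then 1 else 0) ^ 2 =
        s * a i ^ 2 + Real.exp (l i) * (1 - 2 * a i) := by
      have : ∀ j, Real.exp (l j) * (a i - if i = j then 1 else 0) ^ 2 =
          Real.exp (l j) * a i ^ 2 + if i = j then Real.exp (l j) * (1 - 2 * a i) else 0 := by
        intro j
        split_ifs <;> ring
      rw [Finset.sum_congr rfl fun j _ => this j, Finset.sum_add_distrib, ← Finset.sum_mul]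
      simp [hs]
    have h2 : Real.exp (l i) * (Real.exp (l i) / s) ≤
        Real.exp (l i + r * (l i - κ)) + Real.exp κ * (Real.exp (l i) / s) := by
      have hd : Real.exp (l i) / s ≤ 1 := (div_le_one hs0).2 (hle i)
      have hd0 : 0 ≤ Real.exp (l i) / s := by positivity
      rcases le_total (l i) κ with h | h
      · have : Real.exp (l i) * (Real.exp (l i) / s) ≤ Real.exp κ * (Real.exp (l i) / s) := by
          gcongr
        linarith [Real.exp_pos (l i + r * (l i - κ))]
      · have h3 : Real.exp (l i) ≤ Real.exp (l i + r * (l i - κ)) :=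
          Real.exp_le_exp.2 (by nlinarith)
        have h4 : Real.exp (l i) * (Real.exp (l i) / s) ≤ Real.exp (l i) * 1 := by gcongr
        have h5 : 0 ≤ Real.exp κ * (Real.exp (l i) / s) := by positivity
        linarith
    have h3 : 0 ≤ s * (a i - Real.exp (l i) / s) ^ 2 := by positivity
    have h4 : s * (a i - Real.exp (l i) / s) ^ 2 =
        s * a i ^ 2 - 2 * a i * Real.exp (l i) + Real.exp (l i) * (Real.exp (l i) / s) := by
      field_simp
      ring
    rw [h1]
    linarith
  have hsum := Finset.sum_le_sum fun i (_ : i ∈ Finset.univ) => key i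
  rw [Finset.sum_add_distrib, Finset.sum_add_distrib, ← Finset.mul_sum, ← Finset.sum_div,
    ← hs, Finset.sum_comm] at hsum
  refine hsum.trans ?_
  gcongr
  -- The weights sum to `s / s`, which is `0` rather than `1` when `ι` is empty.
  exact mul_le_of_le_one_right (Real.exp_pos _).le (div_self_le_one s)

/-- A lower bound for the total risk, over the positions of a single spike in a block of
coordinates, of estimating the means in that block. -/
lemma ofReal_le_sum_block_risk {m n : ℕ} {S : Matrix (Fin k) (Fin k) ℝ}
    {W : EuclideanSpace ℝ (Fin k) →L[ℝ] EuclideanSpace ℝ (Fin k)}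
    (hmW : ∀ x, mahalanobisSq S x = ‖W x‖ ^ 2)
    (hW : ∀ z, W (Matrix.toEuclideanCLM (𝕜 := ℝ) (CFC.sqrt S) z) = z)
    {e : EuclideanSpace ℝ (Fin k)} (he : ‖e‖ = 1) {τ : ℝ} (hτ : 0 < τ) {r : ℝ} (hr : 0 ≤ r) (κ : ℝ)
    {θ : Fin n → EuclideanSpace ℝ (Fin k)} {f : Fin m → Fin n} (hf : Function.Injective f)
    (hθ : ∀ j, θ (f j) = 0)
    {δ : (Fin n → EuclideanSpace ℝ (Fin k)) → Fin n → EuclideanSpace ℝ (Fin k)}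
    (hδ : Measurable δ) :
    ENNReal.ofReal (τ ^ 2 * (m - (m * Real.exp (r * (1 + r) * τ ^ 2 / 2 - r * κ) + Real.exp κ))) ≤
      ∑ j, ∑ i, ∫⁻ x, ENNReal.ofReal (mahalanobisSq S (δ x (f i) - Function.update θ (f j)
          (τ • Matrix.toEuclideanCLM (𝕜 := ℝ) (CFC.sqrt S) e) (f i)))
        ∂dataLaw S (Function.update θ (f j)
          (τ • Matrix.toEuclideanCLM (𝕜 := ℝ) (CFC.sqrt S) e)) := by
  set u := Matrix.toEuclideanCLM (𝕜 := ℝ) (CFC.sqrt S) e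
  have hWu : W u = e := hW e
  have hδi : ∀ i, Measurable fun x => δ x i := fun i => (measurable_pi_apply i).comp hδ
  set c := Real.exp (r * (1 + r) * τ ^ 2 / 2 - r * κ) with hc
  have hpt : ∀ x, ENNReal.ofReal (τ ^ 2) * ∑ j, ENNReal.ofReal (Real.exp (logLik W e τ (x (f j)))) ≤
      ∑ j, ∑ i, ENNReal.ofReal (Real.exp (logLik W e τ (x (f j)))) *
        ENNReal.ofReal (mahalanobisSq S (δ x (f i) - Function.update θ (f j) (τ • u) (f i))) +
      ENNReal.ofReal (τ ^ 2) * (∑ j, ENNReal.ofReal c *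
        ENNReal.ofReal (Real.exp (logLik W e ((1 + r) * τ) (x (f j)))) +
        ENNReal.ofReal (Real.exp κ)) := by
    intro x
    have h := sum_exp_le_sum_mul_loss (fun j => logLik W e τ (x (f j)))
      (fun i => inner ℝ e (W (δ x (f i))) / τ) κ hr
    -- Projecting the whitened error on the unit vector `e` only decreases it and turns the estimate
    -- into a guess of the spike's indicator.
    have hloss : ∀ i j, τ ^ 2 * (inner ℝ e (W (δ x (f i))) / τ - if i = j then 1 else 0) ^ 2 ≤
        mahalanobisSq S (δ x (f i) - Function.update θ (f j) (τ • u) (f i)) := by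
      intro i j
      rw [hmW, ← mul_pow]
      have h1 : τ * (inner ℝ e (W (δ x (f i))) / τ - if i = j then 1 else 0) =
          inner ℝ e (W (δ x (f i) - Function.update θ (f j) (τ • u) (f i))) := by
        rw [map_sub, inner_sub_right, mul_sub, mul_div_cancel₀ _ hτ.ne']
        congr 1
        split_ifs with hij
        · subst hij
          rw [Function.update_self, map_smul, hWu, inner_smul_right, real_inner_self_eq_norm_sq, he]
          simp
        · rw [Function.update_of_ne (fun hh => hij (hf hh)), hθ]
          simp
      rw [h1, sq_le_sq, abs_norm]
      refine (abs_real_inner_le_norm _ _).trans ?_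
      rw [he, one_mul]
    -- The Chernoff factor is again a likelihood ratio, for a spike of length `(1 + r) τ`, up to the
    -- constant `c`; its integral is therefore exactly `c`.
    have hexp : ∀ j, Real.exp (logLik W e τ (x (f j)) + r * (logLik W e τ (x (f j)) - κ)) =
        c * Real.exp (logLik W e ((1 + r) * τ) (x (f j))) := by
      intro j
      rw [hc, ← Real.exp_add]
      congr 1
      simp only [logLik]
      ring
    have hm0 : ∀ y, 0 ≤ mahalanobisSq S y := fun y => by rw [hmW]; positivity
    have hc0 : 0 ≤ c := (Real.exp_pos _).le
    have hreal : τ ^ 2 * ∑ j, Real.exp (logLik W e τ (x (f j))) ≤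
        ∑ j, ∑ i, Real.exp (logLik W e τ (x (f j))) *
          mahalanobisSq S (δ x (f i) - Function.update θ (f j) (τ • u) (f i)) +
        τ ^ 2 * (∑ j, c * Real.exp (logLik W e ((1 + r) * τ) (x (f j))) + Real.exp κ) := by
      simp_rw [hexp] at h
      have h' := mul_le_mul_of_nonneg_left h (sq_nonneg τ)
      refine h'.trans ?_
      rw [add_assoc, mul_add]
      gcongr
      rw [Finset.mul_sum]
      refine Finset.sum_le_sum fun j _ => ?_
      rw [Finset.mul_sum]
      refine Finset.sum_le_sum fun i _ => ?_
      rw [mul_left_comm]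
      gcongr
      exact hloss i j
    have := ENNReal.ofReal_le_ofReal hreal
    rw [ENNReal.ofReal_mul (by positivity), ENNReal.ofReal_sum_of_nonneg (by intros; positivity),
      ENNReal.ofReal_add (Finset.sum_nonneg fun j _ => Finset.sum_nonneg fun i _ =>
        mul_nonneg (Real.exp_pos _).le (hm0 _)) (by positivity),
      ENNReal.ofReal_mul (by positivity), ENNReal.ofReal_add (by positivity) (by positivity),
      ENNReal.ofReal_sum_of_nonneg (fun j _ => Finset.sum_nonneg fun i _ =>
        mul_nonneg (Real.exp_pos _).le (hm0 _)),
      ENNReal.ofReal_sum_of_nonneg (by intros; positivity)] at this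
    refine this.trans (le_of_eq ?_)
    congr 1
    · refine Finset.sum_congr rfl fun j _ => ?_
      rw [ENNReal.ofReal_sum_of_nonneg fun i _ => mul_nonneg (Real.exp_pos _).le (hm0 _)]
      exact Finset.sum_congr rfl fun i _ => ENNReal.ofReal_mul (Real.exp_pos _).le
    · congr 2
      exact Finset.sum_congr rfl fun j _ => ENNReal.ofReal_mul hc0
  have hmS : Measurable (mahalanobisSq S) := by
    have : mahalanobisSq S = fun x => ‖W x‖ ^ 2 := funext hmW
    rw [this]
    fun_prop
  have hL : ∀ s j, Measurable fun x : Fin n → EuclideanSpace ℝ (Fin k) =>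
      ENNReal.ofReal (Real.exp (logLik W e s (x (f j)))) := by
    intro s j
    fun_prop
  have hl : ∀ i j, Measurable fun x : Fin n → EuclideanSpace ℝ (Fin k) => ENNReal.ofReal
      (mahalanobisSq S (δ x (f i) - Function.update θ (f j) (τ • u) (f i))) := fun i j =>
    (hmS.comp ((hδi _).sub measurable_const)).ennreal_ofReal
  have hLl : ∀ i j, Measurable fun x : Fin n → EuclideanSpace ℝ (Fin k) =>
      ENNReal.ofReal (Real.exp (logLik W e τ (x (f j)))) * ENNReal.ofReal
        (mahalanobisSq S (δ x (f i) - Function.update θ (f j) (τ • u) (f i))) := fun i j =>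
    (hL τ j).mul (hl i j)
  have hone : ∀ s j, ∫⁻ x, ENNReal.ofReal (Real.exp (logLik W e s (x (f j)))) ∂dataLaw S θ = 1 := by
    intro s j
    rw [lintegral_dataLaw_eval S θ (f j)
      (g := fun y => ENNReal.ofReal (Real.exp (logLik W e s y))) (by fun_prop), hθ]
    exact lintegral_exp_logLik hW he s
  have hint := lintegral_mono hpt (μ := dataLaw S θ)
  have : IsProbabilityMeasure (dataLaw S θ) := by
    unfold dataLaw
    infer_instance
  rw [lintegral_const_mul' _ _ ENNReal.ofReal_ne_top, lintegral_finsetSum _ fun j _ => hL τ j,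
    lintegral_add_left (Finset.measurable_fun_sum _ fun j _ => Finset.measurable_fun_sum _
      fun i _ => hLl i j),
    lintegral_const_mul' _ _ ENNReal.ofReal_ne_top,
    lintegral_add_right _ measurable_const, lintegral_const, measure_univ, mul_one,
    lintegral_finsetSum _ fun j _ => (hL _ j).const_mul _,
    lintegral_finsetSum _ fun j _ => Finset.measurable_fun_sum _
      fun i _ => hLl i j] at hint
  simp_rw [lintegral_const_mul' _ _ ENNReal.ofReal_ne_top, hone] at hint
  -- Absorbing the likelihood into the measure recovers the risk under the law with the spike.
  have hrisk : ∀ j, ∫⁻ x, ∑ i, ENNReal.ofReal (Real.exp (logLik W e τ (x (f j)))) *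
        ENNReal.ofReal (mahalanobisSq S (δ x (f i) - Function.update θ (f j) (τ • u) (f i)))
        ∂dataLaw S θ =
      ∑ i, ∫⁻ x, ENNReal.ofReal (mahalanobisSq S (δ x (f i) - Function.update θ (f j) (τ • u) (f i)))
        ∂dataLaw S (Function.update θ (f j) (τ • u)) := by
    intro j
    rw [lintegral_finsetSum _ fun i _ => hLl i j]
    refine Finset.sum_congr rfl fun i _ => ?_
    rw [dataLaw_update_eq_withDensity hW he τ (hθ j),
      lintegral_withDensity_eq_lintegral_mul _ (hL τ j) (hl i j)]
    rfl
  simp_rw [hrisk] at hint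
  simp only [Finset.sum_const, Finset.card_univ, Fintype.card_fin, nsmul_eq_mul, mul_one] at hint
  rw [mul_sub, ENNReal.ofReal_sub _ (by positivity), tsub_le_iff_right,
    ENNReal.ofReal_mul (by positivity), ENNReal.ofReal_mul (by positivity),
    ENNReal.ofReal_add (by positivity) (by positivity), ENNReal.ofReal_mul (by positivity),
    ENNReal.ofReal_natCast]
  exact hint

/-! ### Lower bound: the block prior -/

/-- Resampling one coordinate does not change the sum over all functions. -/
lemma sum_sum_update {β α M : Type*} [Fintype β] [DecidableEq β] [Fintype α] [AddCommMonoid M]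
    (G : (β → α) → M) (b : β) :
    ∑ J : β → α, ∑ j, G (Function.update J b j) = Fintype.card α • ∑ J, G J := by
  -- Swapping the old value `J b` with the new value `j` is a bijection of the pairs.
  have hinv : Function.Involutive
      fun p : (β → α) × α => (Function.update p.1 b p.2, p.1 b) := by
    rintro ⟨J, j⟩
    simp
  rw [← Fintype.sum_prod_type', Function.Bijective.sum_comp hinv.bijective (fun p => G p.1),
    Fintype.sum_prod_type, Finset.smul_sum]
  simp

/-- A lower bound for the minimax risk by the Bayes risk for `q` blocks of `m` coordinates with a
single spike at a uniform position in each of them. -/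
lemma ofReal_le_minimaxRisk {m n q : ℕ} (hm : 0 < m) (hmn : q * m ≤ n)
    {S : Matrix (Fin k) (Fin k) ℝ} (hS : S.PosDef) (hk : 0 < k) {τ : ℝ} (hτ : 0 < τ)
    {r : ℝ} (hr : 0 ≤ r) (κ : ℝ) :
    ENNReal.ofReal (q * (τ ^ 2 *
      (1 - (Real.exp (r * (1 + r) * τ ^ 2 / 2 - r * κ) + Real.exp κ / m)))) ≤
      minimaxRisk S n q := by
  classical
  obtain ⟨W, hmW, hW⟩ := exists_whitening hS
  obtain ⟨e, he⟩ : ∃ e : EuclideanSpace ℝ (Fin k), ‖e‖ = 1 :=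
    ⟨EuclideanSpace.single ⟨0, hk⟩ 1, by simp⟩
  set u := Matrix.toEuclideanCLM (𝕜 := ℝ) (CFC.sqrt S) e
  obtain ⟨φ⟩ : Nonempty (Fin q × Fin m ↪ Fin n) :=
    Function.Embedding.nonempty_of_card_le (by simpa using hmn)
  refine le_iInf₂ fun δ hδ => ?_
  set R := ⨆ θ ∈ nearlyBlack k n q, risk S δ θ
  let θ : (Fin q → Fin m) → Fin n → EuclideanSpace ℝ (Fin k) := fun J i =>
    if ∃ b, φ (b, J b) = i then τ • u else 0
  let base : (Fin q → Fin m) → Fin q → Fin n → EuclideanSpace ℝ (Fin k) := fun J b i =>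
    if ∃ b', b' ≠ b ∧ φ (b', J b') = i then τ • u else 0
  have hθmem : ∀ J, θ J ∈ nearlyBlack k n q := by
    intro J
    have hsub : {i | θ J i ≠ 0} ⊆ Set.range fun b => φ (b, J b) := by
      intro i hi
      by_contra hcon
      exact hi (if_neg hcon)
    refine (Set.ncard_le_ncard hsub (Set.finite_range _)).trans ?_
    rw [← Set.image_univ]
    refine (Set.ncard_image_le Set.finite_univ).trans ?_
    simp
  have hupd : ∀ J b j, θ (Function.update J b j) = Function.update (base J b) (φ (b, j)) (τ • u) := by
    intro J b j
    ext1 i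
    by_cases hi : i = φ (b, j)
    · subst hi
      rw [Function.update_self]
      exact if_pos ⟨b, by simp⟩
    · rw [Function.update_of_ne hi]
      refine if_congr ⟨?_, ?_⟩ rfl rfl
      · rintro ⟨b', hb'⟩
        have hne : b' ≠ b := by
          rintro rfl
          exact hi (by simpa using hb'.symm)
        exact ⟨b', hne, by rwa [Function.update_of_ne hne] at hb'⟩
      · rintro ⟨b', hne, hb'⟩
        exact ⟨b', by rwa [Function.update_of_ne hne]⟩
  have hbase : ∀ J b j, base J b (φ (b, j)) = 0 := by
    intro J b j
    refine if_neg ?_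
    rintro ⟨b', hne, hb'⟩
    exact hne (Prod.ext_iff.1 (φ.injective hb')).1
  let G : Fin q → (Fin q → Fin m) → ℝ≥0∞ := fun b J =>
    ∑ i, ∫⁻ x, ENNReal.ofReal (mahalanobisSq S (δ x (φ (b, i)) - θ J (φ (b, i)))) ∂dataLaw S (θ J)
  have hG : ∀ J, ∑ b, G b J ≤ R := by
    intro J
    refine le_trans ?_ (le_iSup₂ (f := fun θ (_ : θ ∈ nearlyBlack k n q) => risk S δ θ) _ (hθmem J))
    rw [← Fintype.sum_prod_type', risk]
    rw [← Finset.sum_map Finset.univ φ (fun i => ∫⁻ x, ENNReal.ofReal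
      (mahalanobisSq S (δ x i - θ J i)) ∂dataLaw S (θ J))]
    exact Finset.sum_le_sum_of_subset (Finset.subset_univ _)
  set c := Real.exp (r * (1 + r) * τ ^ 2 / 2 - r * κ) with hc
  have hblock : ∀ b J, ENNReal.ofReal (τ ^ 2 * (m - (m * c + Real.exp κ))) ≤
      ∑ j, G b (Function.update J b j) := by
    intro b J
    have h := ofReal_le_sum_block_risk (f := fun j => φ (b, j)) hmW hW he hτ hr κ
      (fun i j hij => (Prod.ext_iff.1 (φ.injective hij)).2) (hbase J b) hδ
    simp only [G, hupd]
    exact h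
  set A := ENNReal.ofReal (τ ^ 2 * (m - (m * c + Real.exp κ))) with hA
  set N : ℝ≥0∞ := (Fintype.card (Fin q → Fin m) : ℝ≥0∞) with hN
  have hN0 : N ≠ 0 := by
    have : Nonempty (Fin q → Fin m) := ⟨fun _ => ⟨0, hm⟩⟩
    simpa [hN] using Fintype.card_ne_zero (α := Fin q → Fin m)
  -- Resampling the spike of block `b` with the other blocks frozen gives the one-block bound for
  -- each `J`; summing over all `J` replaces conditioning on the other blocks.
  have htot : N * (q * A) ≤ N * (m * R) := by
    calc N * (q * A) = ∑ _b : Fin q, ∑ _J : Fin q → Fin m, A := by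
          simp only [Finset.sum_const, Finset.card_univ, Fintype.card_fin, nsmul_eq_mul, hN]
          ring
      _ ≤ ∑ b : Fin q, ∑ J : Fin q → Fin m, ∑ j, G b (Function.update J b j) :=
          Finset.sum_le_sum fun b _ => Finset.sum_le_sum fun J _ => hblock b J
      _ = m * ∑ J : Fin q → Fin m, ∑ b, G b J := by
          simp_rw [sum_sum_update]
          rw [← Finset.smul_sum, Finset.sum_comm, Fintype.card_fin, nsmul_eq_mul]
      _ ≤ m * ∑ _J : Fin q → Fin m, R := by
          gcongr with J
          exact hG J
      _ = N * (m * R) := by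
          simp only [Finset.sum_const, Finset.card_univ, nsmul_eq_mul, hN]
          ring
  have hqR : q * A ≤ m * R := (ENNReal.mul_le_mul_iff_right hN0 (ENNReal.natCast_ne_top _)).1 htot
  have hm' : (0 : ℝ) < m := by exact_mod_cast hm
  rw [← ENNReal.mul_le_mul_iff_right (a := (m : ℝ≥0∞)) (by exact_mod_cast hm.ne')
    (ENNReal.natCast_ne_top _)]
  refine le_trans (le_of_eq ?_) hqR
  rw [hA, ← ENNReal.ofReal_natCast, ← ENNReal.ofReal_natCast, ← ENNReal.ofReal_mul (by positivity),
    ← ENNReal.ofReal_mul (by positivity)]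
  congr 1
  field_simp

/-- No estimator beats the asymptotic minimax risk. -/
lemma exists_forall_le_minimaxRisk {S : Matrix (Fin k) (Fin k) ℝ} (hS : S.PosDef) (hk : 0 < k)
    {ε : ℝ} (hε : 0 < ε) :
    ∃ T : ℝ, ∀ n q : ℕ, 0 < q → T * q ≤ n →
      ENNReal.ofReal (2 * (q : ℝ) * Real.log ((n : ℝ) / (q : ℝ)) * (1 - ε)) ≤
        minimaxRisk S n q := by
  obtain ⟨η, hη, hη1, hηε⟩ : ∃ η : ℝ, 0 < η ∧ η ≤ 1 / 2 ∧ 3 * η ≤ ε :=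
    ⟨min (ε / 3) (1 / 2), by positivity, min_le_right _ _, by linarith [min_le_left (ε / 3) (1 / 2)]⟩
  -- Chosen so that `η² / 16 * ℓ₀ = (η / 2)⁻¹`, as `hsmall` needs.
  set ℓ₀ := 32 / η ^ 3 with hℓ₀
  have hℓ₀pos : 0 < ℓ₀ := by positivity
  -- One `log 2` pays for rounding `n / q` down, and `log 2 / η` makes that loss at most a fraction
  -- `η` of `Λ`.
  refine ⟨Real.exp (ℓ₀ + Real.log 2 + Real.log 2 / η), fun n q hq hn => ?_⟩
  have hlog2 : 0 < Real.log 2 := Real.log_pos one_lt_two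
  have hq' : (0 : ℝ) < q := by exact_mod_cast hq
  have hn' : (0 : ℝ) < n := lt_of_lt_of_le (by positivity) hn
  set Λ := Real.log ((n : ℝ) / q) with hΛ
  have hΛ1 : ℓ₀ + Real.log 2 + Real.log 2 / η ≤ Λ := by
    rw [hΛ, Real.le_log_iff_exp_le (by positivity), le_div_iff₀ hq']
    exact hn
  have hlogη : 0 < Real.log 2 / η := by positivity
  have hΛ0 : 0 < Λ := by linarith
  have hratio : 2 ≤ (n : ℝ) / q := by
    rw [← Real.log_le_log_iff (by norm_num) (by positivity)]
    linarith
  set m := n / q with hm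
  have hm1 : (n : ℝ) / q < m + 1 := by
    rw [div_lt_iff₀ hq']
    exact_mod_cast Nat.lt_mul_of_div_lt (Nat.lt_succ_self _) hq
  have hm2 : (n : ℝ) / q / 2 ≤ m := by linarith
  have hmpos : (0 : ℝ) < m := lt_of_lt_of_le (by positivity) hm2
  set l := Real.log m with hl
  have hl1 : Λ - Real.log 2 ≤ l := by
    rw [hΛ, ← Real.log_div (by positivity) (by norm_num)]
    exact Real.log_le_log (by positivity) hm2
  have hl0 : ℓ₀ ≤ l := by linarith
  have hlpos : 0 < l := by linarith
  have hlη : (1 - η) * Λ ≤ l := by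
    have : Real.log 2 ≤ Λ * η := (div_le_iff₀ hη).1 (by linarith)
    linarith
  set τ := Real.sqrt (2 * (1 - η) * l) with hτ
  have hτ2 : τ ^ 2 = 2 * (1 - η) * l := Real.sq_sqrt (mul_nonneg (by linarith) hlpos.le)
  have hτ0 : 0 < τ := Real.sqrt_pos.2 (mul_pos (by linarith) hlpos)
  -- The cutoff `κ = (1 - η / 2) l` lies halfway between `τ² / 2 = (1 - η) l`, the mean
  -- log-likelihood under the spike, and `l = log m`; so both error terms are exponentially small in
  -- `l`.
  refine le_trans (ENNReal.ofReal_le_ofReal ?_) (ofReal_le_minimaxRisk (m := m) (n := n) (q := q)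
    (by exact_mod_cast hmpos) (Nat.mul_div_le n q) hS hk hτ0 (r := η / 4) (by positivity)
    ((1 - η / 2) * l))
  have hsmall : Real.exp (-(η ^ 2 / 16 * l)) ≤ η / 2 := by
    rw [Real.exp_neg, inv_le_comm₀ (Real.exp_pos _) (by positivity)]
    have h1 : η ^ 2 / 16 * ℓ₀ ≤ η ^ 2 / 16 * l := by gcongr
    have h2 : η ^ 2 / 16 * ℓ₀ = (η / 2)⁻¹ := by
      rw [hℓ₀]
      field_simp
      norm_num
    linarith [Real.add_one_le_exp (η ^ 2 / 16 * l)]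
  have hfirst : Real.exp (η / 4 * (1 + η / 4) * τ ^ 2 / 2 - η / 4 * ((1 - η / 2) * l)) ≤ η / 2 := by
    refine le_trans (Real.exp_le_exp.2 ?_) hsmall
    rw [hτ2]
    have : 0 ≤ η ^ 3 * l := by positivity
    nlinarith
  have hsecond : Real.exp ((1 - η / 2) * l) / m ≤ η / 2 := by
    refine le_trans ?_ hsmall
    have : (m : ℝ) = Real.exp l := (Real.exp_log hmpos).symm
    rw [this, ← Real.exp_sub]
    apply Real.exp_le_exp.2
    have : η ^ 2 * l ≤ 1 * η * l := by
      rw [sq]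
      gcongr
      linarith
    nlinarith [mul_pos hη hlpos]
  have h1 : 1 - η ≤ 1 - (Real.exp (η / 4 * (1 + η / 4) * τ ^ 2 / 2 - η / 4 * ((1 - η / 2) * l)) +
      Real.exp ((1 - η / 2) * l) / m) := by linarith
  have h1η : 0 ≤ 1 - η := by linarith
  -- The three factors come from rounding, from the choice of `τ²`, and from the Bayes risk as a
  -- fraction of `τ²`.
  have h2 : 1 - ε ≤ (1 - η) * ((1 - η) * (1 - η)) := by nlinarith
  calc 2 * (q : ℝ) * Λ * (1 - ε) ≤ 2 * (q : ℝ) * Λ * ((1 - η) * ((1 - η) * (1 - η))) := by gcongr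
    _ = q * (2 * (1 - η) * ((1 - η) * Λ) * (1 - η)) := by ring
    _ ≤ q * (2 * (1 - η) * l * (1 - η)) := by gcongr
    _ ≤ _ := by
      rw [← hτ2]
      gcongr

end NearlyBlack

end

/-! ### Passage to the limit -/

theorem theorem1 {k : ℕ} (hk : 0 < k) (S : Matrix (Fin k) (Fin k) ℝ) (hS : S.PosDef)
    (q : ℕ → ℕ) (hq : (fun n => (q n : ℝ)) =o[atTop] fun n => (n : ℝ)) :
    ∃ ε : ℕ → ℝ, Tendsto ε atTop (𝓝 0) ∧
      ∀ᶠ n in atTop, NearlyBlack.minimaxRisk S n (q n) =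
        ENNReal.ofReal (2 * (q n : ℝ) * Real.log ((n : ℝ) / (q n : ℝ)) * (1 + ε n)) := by
  have hT : ∀ T : ℝ, ∀ᶠ n in atTop, T * q n ≤ n := by
    intro T
    filter_upwards [hq.bound (c := (|T| + 1)⁻¹) (by positivity)] with n hn
    rw [Real.norm_of_nonneg (by positivity), Real.norm_of_nonneg (by positivity),
      inv_mul_eq_div, le_div_iff₀ (by positivity)] at hn
    nlinarith [le_abs_self T, (Nat.cast_nonneg (q n) : (0 : ℝ) ≤ q n)]
  have hpos : ∀ᶠ n in atTop, 0 < q n →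
      0 < 2 * (q n : ℝ) * Real.log ((n : ℝ) / (q n : ℝ)) := by
    filter_upwards [hT 2] with n hn hqn
    have hq' : (0 : ℝ) < q n := by exact_mod_cast hqn
    have : 0 < Real.log ((n : ℝ) / (q n : ℝ)) := Real.log_pos (by
      rw [lt_div_iff₀ hq']
      linarith)
    positivity
  -- Used only for finiteness of the minimax risk, so that `toReal` loses nothing.
  obtain ⟨T₁, hT₁⟩ := NearlyBlack.exists_forall_minimaxRisk_le hS one_pos
  -- The relative error itself; it is set to `0` when `q n = 0`, where both sides vanish.
  refine ⟨fun n => if q n = 0 then 0 else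
    (NearlyBlack.minimaxRisk S n (q n)).toReal / (2 * (q n : ℝ) * Real.log ((n : ℝ) / (q n : ℝ))) - 1, ?_, ?_⟩
  · rw [Metric.tendsto_nhds]
    intro ε hε
    obtain ⟨T₂, hT₂⟩ := NearlyBlack.exists_forall_minimaxRisk_le hS (half_pos hε)
    obtain ⟨T₃, hT₃⟩ := NearlyBlack.exists_forall_le_minimaxRisk hS hk (half_pos hε)
    filter_upwards [hT T₂, hT T₃, hpos] with n h₂ h₃ hp
    by_cases hqn : q n = 0
    · simpa [hqn] using hε
    have hqn' := Nat.pos_of_ne_zero hqn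
    specialize hp hqn'
    have hup := hT₂ n (q n) hqn' h₂
    have hlo := hT₃ n (q n) hqn' h₃
    have hfin := ne_top_of_le_ne_top ENNReal.ofReal_ne_top hup
    have hup' := ENNReal.toReal_le_of_le_ofReal (by positivity) hup
    have hlo' := (ENNReal.ofReal_le_iff_le_toReal hfin).1 hlo
    rw [if_neg hqn, Real.dist_eq, sub_zero, abs_lt]
    have a1 := (div_le_iff₀' hp).2 hup'
    have a2 := (le_div_iff₀' hp).2 hlo'
    constructor <;> linarith
  · filter_upwards [hT T₁, hpos] with n h₁ hp
    by_cases hqn : q n = 0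
    · simp [hqn, NearlyBlack.minimaxRisk_zero]
    have hqn' := Nat.pos_of_ne_zero hqn
    specialize hp hqn'
    have hfin := ne_top_of_le_ne_top ENNReal.ofReal_ne_top (hT₁ n (q n) hqn' h₁)
    rw [if_neg hqn, add_sub_cancel, mul_div_cancel₀ _ hp.ne', ENNReal.ofReal_toReal hfin]
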